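/- Let $\phi,\psi:[0,1]\to\mathbb{R}$ be nondecreasing functions with $\phi(0)=\psi(0)=0$ and $\phi(1)=\psi(1)=1$, such that the functions $$\phi^*:(0,1]\to[1,\infty),\quad \phi^*(u)=\frac{\phi(u)}{u},\qquad \psi_*:(0,1)\to[1,\infty],\quad \psi_*(v)=\frac{1-\psi(v)}{v-\psi(v)}$$ (with $\psi_*(v)=\infty$ if $\psi(v)=v$) are well defined, i.e. take values in the indicated sets, and are nonincreasing. The maxmin copula generated by $\phi,\psi$ is $$C_{\phi,\psi}(u,v)=\min\{u,\ \phi(u)v-\phi(u)\psi(v)+u\psi(v)\},\qquad (u,v)\in[0,1]^2.$$ It induces a unique Borel probability measure $\mu$ on $[0,1]^2$ with $\mu([0,u]\times[0,v])=C_{\phi,\psi}(u,v)$ for all $u,v\in[0,1]$. The singular component of $C_{\phi,\psi}$ is the singular part of $\mu$ in its Lebesgue decomposition with respect to two-dimensional Lebesgue measure, and $C_{\phi,\psi}$ is called fully singular if $\mu$ is singular with respect to Lebesgue measure. Then the singular component of $C_{\phi,\psi}$ is concentrated on the curve $$\{(u,v)\in(0,1]\times(0,1)\ :\ \phi^*(u)=\psi_*(v)\},$$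 i.e. it gives measure $0$ to the complement of this set. Moreover, the only fully singular maxmin copula is the Fréchet–Hoeffding upper bound $M(u,v)=\min\{u,v\}$; that is, $M$ is a fully singular maxmin copula, and every fully singular maxmin copula equals $M$ on $[0,1]^2$. -/

import Mathlib

open Set MeasureTheory

/-- The function `φ* : (0,1] → ℝ`, `φ*(u) = φ(u) / u`. It is only used for `u ∈ (0,1]`. -/
noncomputable def phiStar (φ : ℝ → ℝ) (u : ℝ) : ℝ := φ u / u

open scoped Classical in
/-- The extended-real valued function `ψ_*(v) = (1 - ψ(v)) / (v - ψ(v))`, with `ψ_*(v) = ∞` if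
`ψ(v) = v`. It is only used for `v ∈ (0,1)`. -/
noncomputable def psiStar (ψ : ℝ → ℝ) (v : ℝ) : EReal :=
  if ψ v = v then ⊤ else (((1 - ψ v) / (v - ψ v) : ℝ) : EReal)

/-- A pair of generating functions `φ, ψ : [0,1] → ℝ` of a maxmin copula. The functions are given
on all of `ℝ`, and only their values on `[0,1]` matter. -/
structure IsMaxminGenerators (φ ψ : ℝ → ℝ) : Prop where
  phi_zero : φ 0 = 0
  psi_zero : ψ 0 = 0
  phi_one : φ 1 = 1
  psi_one : ψ 1 = 1
  phi_mono : MonotoneOn φ (Icc 0 1)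
  psi_mono : MonotoneOn ψ (Icc 0 1)
  /-- `φ*` maps `(0,1]` into `[1,∞)`. -/
  one_le_phiStar : ∀ u ∈ Ioc (0 : ℝ) 1, 1 ≤ phiStar φ u
  /-- `ψ_*` maps `(0,1)` into `[1,∞]`. -/
  one_le_psiStar : ∀ v ∈ Ioo (0 : ℝ) 1, 1 ≤ psiStar ψ v
  phiStar_anti : AntitoneOn (phiStar φ) (Ioc 0 1)
  psiStar_anti : AntitoneOn (psiStar ψ) (Ioo 0 1)

/-- The function `C_{φ,ψ}(u,v) = min {u, φ(u) v - φ(u) ψ(v) + u ψ(v)}`. -/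
noncomputable def maxminFun (φ ψ : ℝ → ℝ) (u v : ℝ) : ℝ :=
  min u (φ u * v - φ u * ψ v + u * ψ v)

/-- `C`, regarded as a function on `[0,1]²`, is a maxmin copula. -/
def IsMaxminCopula (C : ℝ → ℝ → ℝ) : Prop :=
  ∃ φ ψ : ℝ → ℝ, IsMaxminGenerators φ ψ ∧
    ∀ u ∈ Icc (0 : ℝ) 1, ∀ v ∈ Icc (0 : ℝ) 1, C u v = maxminFun φ ψ u v

/-- `μ` is the probability measure on the unit square (viewed as a measure on the plane) induced by
the copula `C`, that is, `μ ([0,u] × [0,v]) = C(u,v)` for all `u, v ∈ [0,1]`. -/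
structure IsCopulaMeasure (C : ℝ → ℝ → ℝ) (μ : Measure (ℝ × ℝ)) : Prop where
  isProbabilityMeasure : IsProbabilityMeasure μ
  compl_square : μ (Icc (0 : ℝ) 1 ×ˢ Icc (0 : ℝ) 1)ᶜ = 0
  real_rect : ∀ u ∈ Icc (0 : ℝ) 1, ∀ v ∈ Icc (0 : ℝ) 1,
    μ.real (Icc 0 u ×ˢ Icc 0 v) = C u v

/-- `C` is fully singular: it induces a probability measure, and this measure is singular with
respect to Lebesgue measure. -/
def IsFullySingular (C : ℝ → ℝ → ℝ) : Prop :=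
  ∃ μ : Measure (ℝ × ℝ), IsCopulaMeasure C μ ∧ μ ⟂ₘ (volume : Measure (ℝ × ℝ))

/-- The curve `φ*(u) = ψ_*(v)`, with `u ∈ (0,1]` and `v ∈ (0,1)`. -/
def maxminCurve (φ ψ : ℝ → ℝ) : Set (ℝ × ℝ) :=
  {p | p.1 ∈ Ioc (0 : ℝ) 1 ∧ p.2 ∈ Ioo (0 : ℝ) 1 ∧ (phiStar φ p.1 : EReal) = psiStar ψ p.2}

/-! The copula is realised by a shock model. Both `φ` and `h(t) = 1 - ψ(1 - t)` are functions `f`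
with `f` nondecreasing, `f(u)/u` nonincreasing and `f(1) = 1`, and then `u/f(u)` is of the same
kind. For independent uniform X, Y, Z, let U be the larger of the generalized inverse of `φ` at X
and that of `u/φ(u)` at Z. Then P(U ≤ u) = φ(u) · u/φ(u) = u. Let T be built likewise from `h`, Y
and 1 - Z. The pair (U, 1 - T) has distribution function `maxminFun φ ψ`, and a measure on the
square is determined by its distribution function.

Such an `f` is Lipschitz away from 0, so its generalized inverse has an absolutely continuous law
off 0. If U and T are caused by two independent shocks, the pair therefore almost surely avoids any
given null set. Hence on a null set both come from Z: Z = U/φ(U) and 1 - Z = T/h(T). Eliminating Z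
gives the equation of the curve (`ae_lt_of_maxLifetime_mem`, `maxminMeasure_diff_maxminCurve`).

If the measure is singular, U almost surely equals the inverse at Z alone, so u = P(U ≤ u) = u/φ(u)
and φ = 1 on (0,1]. Likewise h = 1, so ψ = 0 on [0,1) and the copula is the minimum
(`eq_one_of_ae_lt`). -/

/-! ### Nondecreasing functions with nonincreasing quotient -/

/-- `f` is nondecreasing on `(0,1]`, `f(u)/u` is nonincreasing there, and `f(1) = 1`. -/
structure IsSubhomogeneous (f : ℝ → ℝ) : Prop where
  mono : MonotoneOn f (Ioc 0 1)
  anti : AntitoneOn (fun u => f u / u) (Ioc 0 1)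
  one : f 1 = 1

namespace IsSubhomogeneous

variable {f h : ℝ → ℝ}

lemma self_le (hf : IsSubhomogeneous f) {u : ℝ} (hu : u ∈ Ioc (0 : ℝ) 1) : u ≤ f u := by
  have := hf.anti hu (right_mem_Ioc.2 one_pos) hu.2
  simp only [hf.one, div_one] at this
  rwa [one_le_div hu.1] at this

lemma pos (hf : IsSubhomogeneous f) {u : ℝ} (hu : u ∈ Ioc (0 : ℝ) 1) : 0 < f u :=
  hu.1.trans_le (hf.self_le hu)

lemma le_one (hf : IsSubhomogeneous f) {u : ℝ} (hu : u ∈ Ioc (0 : ℝ) 1) : f u ≤ 1 := by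
  simpa [hf.one] using hf.mono hu (right_mem_Ioc.2 one_pos) hu.2

lemma mul_le_mul (hf : IsSubhomogeneous f) {u w : ℝ} (hu : u ∈ Ioc (0 : ℝ) 1)
    (hw : w ∈ Ioc (0 : ℝ) 1) (huw : u ≤ w) : f w * u ≤ f u * w := by
  have := hf.anti hu hw huw
  simp only at this
  rwa [div_le_div_iff₀ hw.1 hu.1] at this

/-- The two monotonicity conditions trade places: `u/f(u)` inverts `f(u)/u`, and its quotient by `u`
is `1/f(u)`. -/
lemma conjugate (hf : IsSubhomogeneous f) : IsSubhomogeneous (fun u => u / f u) where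
  mono u hu w hw huw := by
    simp only
    rw [div_le_div_iff₀ (hf.pos hu) (hf.pos hw)]
    linarith [hf.mul_le_mul hu hw huw]
  anti u hu w hw huw := by
    simp only
    rw [div_div, div_div, mul_comm, mul_comm (f u), ← div_div, ← div_div, div_self hw.1.ne',
      div_self hu.1.ne']
    exact one_div_le_one_div_of_le (hf.pos hu) (hf.mono hu hw huw)
  one := by simp [hf.one]

lemma lipschitzOnWith (hf : IsSubhomogeneous f) {ε : NNReal} (hε : 0 < ε) :
    LipschitzOnWith ε⁻¹ f (Icc (ε : ℝ) 1) := by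
  have hε' : (0 : ℝ) < ε := hε
  refine LipschitzOnWith.of_le_add_mul _ fun x hx y hy => ?_
  have hx' : x ∈ Ioc (0 : ℝ) 1 := ⟨hε'.trans_le hx.1, hx.2⟩
  have hy' : y ∈ Ioc (0 : ℝ) 1 := ⟨hε'.trans_le hy.1, hy.2⟩
  have hd : 0 ≤ ((ε⁻¹ : NNReal) : ℝ) * dist x y := by positivity
  rcases le_total x y with hxy | hxy
  · linarith [hf.mono hx' hy' hxy]
  · rw [Real.dist_eq, abs_of_nonneg (sub_nonneg.2 hxy), NNReal.coe_inv, ← div_eq_inv_mul,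
      ← sub_le_iff_le_add', le_div_iff₀ hε']
    have h1 := hf.mul_le_mul hy' hx' hxy
    have h2 := hf.le_one hy'
    have h3 := hf.mono hy' hx' hxy
    nlinarith [hy.1]

lemma volume_image_eq_zero (hf : IsSubhomogeneous f) {N : Set ℝ} (hN : volume N = 0) :
    volume (f '' (N ∩ Ioc 0 1)) = 0 := by
  have hsub : f '' (N ∩ Ioc 0 1) ⊆ ⋃ n : ℕ, f '' (N ∩ Icc (1 / ((n : ℝ) + 1)) 1) := by
    rintro _ ⟨x, ⟨hxN, hx⟩, rfl⟩
    obtain ⟨n, hn⟩ := exists_nat_one_div_lt hx.1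
    exact mem_iUnion.2 ⟨n, x, ⟨hxN, hn.le, hx.2⟩, rfl⟩
  refine measure_mono_null hsub (measure_iUnion_null fun n => ?_)
  have hε : (0 : NNReal) < 1 / ((n : NNReal) + 1) := by positivity
  have hl := (hf.lipschitzOnWith hε).mono (s := N ∩ Icc (1 / ((n : ℝ) + 1)) 1) (by
    intro x hx
    simpa using hx.2)
  have := hl.hausdorffMeasure_image_le (d := 1) zero_le_one
  -- On the line, one-dimensional Hausdorff measure is Lebesgue measure, so Lipschitz maps preserve
  -- null sets.
  rw [hausdorffMeasure_real] at this
  rw [← nonpos_iff_eq_zero]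
  refine this.trans ?_
  rw [measure_mono_null inter_subset_left hN, mul_zero]

end IsSubhomogeneous

/-! ### Generalized inverses -/

/-- The generalized inverse of a nondecreasing function on `(0,1]`. -/
noncomputable def unitInverse (f : ℝ → ℝ) (x : ℝ) : ℝ :=
  -- Truncating `x` at 1 keeps the set nonempty, which avoids `sInf ∅ = 0` and makes the inverse
  -- monotone on all of ℝ.
  sInf {u | u ∈ Ioc (0 : ℝ) 1 ∧ min x 1 ≤ f u}

lemma unitInverse_bddBelow (f : ℝ → ℝ) (x : ℝ) :
    BddBelow {u | u ∈ Ioc (0 : ℝ) 1 ∧ min x 1 ≤ f u} :=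
  ⟨0, fun _ hu => hu.1.1.le⟩

lemma unitInverse_nonneg (f : ℝ → ℝ) (x : ℝ) : 0 ≤ unitInverse f x :=
  Real.sInf_nonneg fun _ hu => hu.1.1.le

namespace IsSubhomogeneous

variable {f h : ℝ → ℝ}

lemma unitInverse_nonempty (hf : IsSubhomogeneous f) (x : ℝ) :
    {u | u ∈ Ioc (0 : ℝ) 1 ∧ min x 1 ≤ f u}.Nonempty :=
  ⟨1, right_mem_Ioc.2 one_pos, by simp [hf.one]⟩

lemma unitInverse_le_one (hf : IsSubhomogeneous f) (x : ℝ) : unitInverse f x ≤ 1 :=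
  csInf_le (unitInverse_bddBelow f x) ⟨right_mem_Ioc.2 one_pos, by simp [hf.one]⟩

lemma measurable_unitInverse (hf : IsSubhomogeneous f) : Measurable (unitInverse f) := by
  refine Monotone.measurable fun x y hxy => ?_
  exact csInf_le_csInf (unitInverse_bddBelow f x) (hf.unitInverse_nonempty y)
    fun u hu => ⟨hu.1, (min_le_min_right 1 hxy).trans hu.2⟩

lemma unitInverse_le_iff (hf : IsSubhomogeneous f) {u x : ℝ} (hu : u ∈ Ioc (0 : ℝ) 1)
    (hx : x ≤ 1) : unitInverse f x ≤ u ↔ x ≤ f u := by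
  constructor
  · intro hle
    by_contra! hlt
    have hfu := hf.pos hu
    -- Since `f w / w ≤ f u / u` for `w ≥ u`, reaching level `x` requires `w ≥ u x / f u > u`. This
    -- replaces a right-continuity argument.
    have : u * (x / f u) ≤ unitInverse f x := by
      refine le_csInf (hf.unitInverse_nonempty x) fun w hw => ?_
      rw [min_eq_left hx] at hw
      have huw : u ≤ w := by
        by_contra! hwu
        linarith [hf.mono hw.1 hu hwu.le, hw.2]
      rw [← mul_div_assoc, div_le_iff₀ hfu]
      nlinarith [hf.mul_le_mul hu hw.1 huw, hw.2, hu.1]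
    have h1 : 1 < x / f u := by rwa [one_lt_div hfu]
    nlinarith [hu.1]
  · intro hle
    exact csInf_le (unitInverse_bddBelow f x) ⟨hu, by rwa [min_eq_left hx]⟩

lemma apply_unitInverse (hf : IsSubhomogeneous f) {x : ℝ} (hx : x ≤ 1)
    (hpos : 0 < unitInverse f x) : f (unitInverse f x) = x := by
  have hu : unitInverse f x ∈ Ioc (0 : ℝ) 1 := ⟨hpos, hf.unitInverse_le_one x⟩
  refine le_antisymm ?_ ((hf.unitInverse_le_iff hu hx).1 le_rfl)
  by_contra! hlt
  set u := unitInverse f x with hudef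
  have hfu := hf.pos hu
  have hx0 : 0 < x := by
    by_contra! hx0
    have h2 : u / 2 ∈ Ioc (0 : ℝ) 1 := ⟨by linarith, by linarith [hu.2]⟩
    have := (hf.unitInverse_le_iff h2 hx).2 (hx0.trans (hf.pos h2).le)
    linarith
  have h1 : x / f u < 1 := by rwa [div_lt_one hfu]
  have hwu : u * (x / f u) < u := by nlinarith
  have hw : u * (x / f u) ∈ Ioc (0 : ℝ) 1 := ⟨by positivity, by linarith [hu.2]⟩
  -- At `w = u x / f u < u` the quotient bound gives `f w ≥ x`, contradicting the infimum.
  have h3 := hf.mul_le_mul hw hu hwu.le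
  have h4 : f u * (u * (x / f u)) = x * u := by field_simp
  rw [h4] at h3
  have := (hf.unitInverse_le_iff hw hx).2 (le_of_mul_le_mul_right h3 hpos)
  linarith

end IsSubhomogeneous

/-! ### Uniform shocks and absolute continuity -/

/-- The uniform distribution on `(0,1)`. -/
noncomputable def unitUniform : Measure ℝ := volume.restrict (Ioo 0 1)

instance : IsProbabilityMeasure unitUniform := ⟨by simp [unitUniform]⟩

lemma ae_unitUniform : ∀ᵐ x ∂unitUniform, x ∈ Ioo (0 : ℝ) 1 :=
  ae_restrict_mem measurableSet_Ioo

lemma unitUniform_Icc {a b : ℝ} (ha : 0 ≤ a) (hb : b ≤ 1) :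
    unitUniform (Icc a b) = ENNReal.ofReal (b - a) := by
  rw [unitUniform, Measure.restrict_congr_set Ioo_ae_eq_Icc, Measure.restrict_apply measurableSet_Icc,
    Icc_inter_Icc, max_eq_left ha, min_eq_left hb, Real.volume_Icc]

lemma unitUniform_Iic {b : ℝ} (hb : b ≤ 1) : unitUniform (Iic b) = ENNReal.ofReal b := by
  rw [← sub_zero b, ← unitUniform_Icc le_rfl hb, sub_zero]
  refine measure_congr ?_
  filter_upwards [ae_unitUniform] with x hx
  exact propext ⟨fun h => ⟨hx.1.le, h⟩, fun h => h.2⟩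

lemma unitUniform_singleton (a : ℝ) : unitUniform {a} = 0 :=
  nonpos_iff_eq_zero.1 ((Measure.restrict_apply_le _ _).trans (by simp))

lemma measurePreserving_one_sub_unitUniform :
    MeasurePreserving (fun x : ℝ => 1 - x) unitUniform unitUniform := by
  have := (Measure.measurePreserving_sub_left (volume : Measure ℝ) 1).restrict_preimage
    (measurableSet_Ioo (a := (0 : ℝ)) (b := 1))
  simpa [unitUniform] using this

namespace IsSubhomogeneous

variable {f h : ℝ → ℝ}

/-- Where the inverse is positive and lies in a null set `N`, `x` lies in the null set `f(N ∩
(0,1])`. The restriction to `Ioi 0` is needed: the inverse has an atom at 0 when `f(0+) > 0`. -/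
lemma map_unitInverse_restrict_absolutelyContinuous (hf : IsSubhomogeneous f) :
    (unitUniform.map (unitInverse f)).restrict (Ioi 0) ≪ volume := by
  refine Measure.AbsolutelyContinuous.mk fun N hN hN0 => ?_
  rw [Measure.restrict_apply hN, Measure.map_apply hf.measurable_unitInverse
    (hN.inter measurableSet_Ioi)]
  rw [unitUniform, Measure.restrict_apply (hf.measurable_unitInverse (hN.inter measurableSet_Ioi))]
  refine measure_mono_null ?_ (hf.volume_image_eq_zero hN0)
  rintro x ⟨⟨hxN, hx0⟩, hx⟩
  exact ⟨unitInverse f x, ⟨hxN, hx0, hf.unitInverse_le_one x⟩, hf.apply_unitInverse hx.2.le hx0⟩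

lemma ae_unitInverse_pair_notMem (hf : IsSubhomogeneous f) (hh : IsSubhomogeneous h)
    {N : Set (ℝ × ℝ)} (hN : volume N = 0) :
    ∀ᵐ q ∂(unitUniform.prod unitUniform), 0 < unitInverse f q.1 → 0 < unitInverse h q.2 →
      (unitInverse f q.1, unitInverse h q.2) ∉ N := by
  have hac := hf.map_unitInverse_restrict_absolutelyContinuous.prod
    hh.map_unitInverse_restrict_absolutelyContinuous
  rw [Measure.prod_restrict, Measure.map_prod_map _ _ hf.measurable_unitInverse
    hh.measurable_unitInverse] at hac
  have h0 : ∀ᵐ p ∂(volume : Measure (ℝ × ℝ)), p ∉ N := measure_eq_zero_iff_ae_notMem.1 hN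
  rw [Measure.volume_eq_prod] at h0
  have h1 := (ae_restrict_iff' (measurableSet_Ioi.prod measurableSet_Ioi)).1 (hac.ae_le h0)
  have h2 := ae_of_ae_map
    (hf.measurable_unitInverse.prodMap hh.measurable_unitInverse).aemeasurable h1
  filter_upwards [h2] with q hq h3 h4
  exact hq ⟨h3, h4⟩

end IsSubhomogeneous

/-! ### The shock model -/

/-- Three independent shocks, each uniform on `(0,1)`. -/
noncomputable def shockLaw : Measure (ℝ × ℝ × ℝ) :=
  unitUniform.prod (unitUniform.prod unitUniform)

instance : IsProbabilityMeasure shockLaw := by unfold shockLaw; infer_instance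

/-- The lifetime which is the maximum of an own shock `x` and the common shock `z`. -/
noncomputable def maxLifetime (f : ℝ → ℝ) (x z : ℝ) : ℝ :=
  max (unitInverse f x) (unitInverse (fun u => u / f u) z)

lemma measurePreserving_shock_fst_snd :
    MeasurePreserving (fun ω : ℝ × ℝ × ℝ => (ω.1, ω.2.1)) shockLaw
      (unitUniform.prod unitUniform) :=
  (MeasurePreserving.id unitUniform).prod measurePreserving_fst

lemma measurePreserving_shock_fst_reflect :
    MeasurePreserving (fun ω : ℝ × ℝ × ℝ => (ω.1, 1 - ω.2.2)) shockLaw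
      (unitUniform.prod unitUniform) :=
  (MeasurePreserving.id unitUniform).prod
    (measurePreserving_one_sub_unitUniform.comp measurePreserving_snd)

lemma measurePreserving_shock_common_snd :
    MeasurePreserving (fun ω : ℝ × ℝ × ℝ => (ω.2.2, ω.2.1)) shockLaw
      (unitUniform.prod unitUniform) :=
  Measure.measurePreserving_swap.comp measurePreserving_snd

lemma measurePreserving_shock_fst :
    MeasurePreserving (fun ω : ℝ × ℝ × ℝ => ω.1) shockLaw unitUniform :=
  measurePreserving_fst

lemma measurePreserving_shock_snd :
    MeasurePreserving (fun ω : ℝ × ℝ × ℝ => ω.2.1) shockLaw unitUniform :=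
  measurePreserving_fst.comp measurePreserving_snd

lemma measurePreserving_shock_common :
    MeasurePreserving (fun ω : ℝ × ℝ × ℝ => ω.2.2) shockLaw unitUniform :=
  measurePreserving_snd.comp measurePreserving_snd

lemma measurePreserving_shock_reflect :
    MeasurePreserving (fun ω : ℝ × ℝ × ℝ => 1 - ω.2.2) shockLaw unitUniform :=
  measurePreserving_one_sub_unitUniform.comp measurePreserving_shock_common

lemma ae_shock_mem : ∀ᵐ ω ∂shockLaw,
    ω.1 ∈ Ioo (0 : ℝ) 1 ∧ ω.2.1 ∈ Ioo (0 : ℝ) 1 ∧ ω.2.2 ∈ Ioo (0 : ℝ) 1 := by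
  filter_upwards [measurePreserving_shock_fst.quasiMeasurePreserving.ae ae_unitUniform,
    measurePreserving_shock_snd.quasiMeasurePreserving.ae ae_unitUniform,
    measurePreserving_shock_common.quasiMeasurePreserving.ae ae_unitUniform] with ω h1 h2 h3
  exact ⟨h1, h2, h3⟩

lemma maxLifetime_nonneg (f : ℝ → ℝ) (x z : ℝ) : 0 ≤ maxLifetime f x z :=
  (unitInverse_nonneg f x).trans (le_max_left _ _)

namespace IsSubhomogeneous

variable {f h : ℝ → ℝ}

lemma maxLifetime_le_one (hf : IsSubhomogeneous f) (x z : ℝ) : maxLifetime f x z ≤ 1 :=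
  max_le (hf.unitInverse_le_one x) (hf.conjugate.unitInverse_le_one z)

lemma measurable_maxLifetime (hf : IsSubhomogeneous f) :
    Measurable (fun q : ℝ × ℝ => maxLifetime f q.1 q.2) :=
  (hf.measurable_unitInverse.comp measurable_fst).max
    (hf.conjugate.measurable_unitInverse.comp measurable_snd)

lemma maxLifetime_le_iff (hf : IsSubhomogeneous f) {u x z : ℝ} (hu : u ∈ Ioc (0 : ℝ) 1)
    (hx : x ≤ 1) (hz : z ≤ 1) : maxLifetime f x z ≤ u ↔ x ≤ f u ∧ z ≤ u / f u := by
  rw [maxLifetime, max_le_iff, hf.unitInverse_le_iff hu hx, hf.conjugate.unitInverse_le_iff hu hz]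

/-- The event is a box up to a null set: X ≤ f(u), Y ≤ h(t), and Z between 1 - t/h(t) and u/f(u). -/
lemma shockLaw_maxLifetime_le (hf : IsSubhomogeneous f) (hh : IsSubhomogeneous h) {u t : ℝ}
    (hu : u ∈ Ioc (0 : ℝ) 1) (ht : t ∈ Ioc (0 : ℝ) 1) :
    shockLaw {ω | maxLifetime f ω.1 ω.2.2 ≤ u ∧ maxLifetime h ω.2.1 (1 - ω.2.2) ≤ t} =
      ENNReal.ofReal (f u * h t * max 0 (u / f u + t / h t - 1)) := by
  have hset : shockLaw {ω | maxLifetime f ω.1 ω.2.2 ≤ u ∧ maxLifetime h ω.2.1 (1 - ω.2.2) ≤ t} =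
      shockLaw (Iic (f u) ×ˢ (Iic (h t) ×ˢ Icc (1 - t / h t) (u / f u))) := by
    refine measure_congr ?_
    filter_upwards [ae_shock_mem] with ω hω
    refine propext ?_
    change (_ ∧ _) ↔ (ω.1 ≤ f u ∧ ω.2.1 ≤ h t ∧ 1 - t / h t ≤ ω.2.2 ∧ ω.2.2 ≤ u / f u)
    rw [hf.maxLifetime_le_iff hu hω.1.2.le hω.2.2.2.le,
      hh.maxLifetime_le_iff ht hω.2.1.2.le (by linarith [hω.2.2.1])]
    constructor
    · rintro ⟨⟨h1, h2⟩, h3, h4⟩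
      exact ⟨h1, h3, by linarith, h2⟩
    · rintro ⟨h1, h3, h4, h2⟩
      exact ⟨⟨h1, h2⟩, h3, by linarith⟩
  rw [hset, shockLaw, Measure.prod_prod, Measure.prod_prod, unitUniform_Iic (hf.le_one hu),
    unitUniform_Iic (hh.le_one ht),
    unitUniform_Icc (by linarith [hh.conjugate.le_one ht]) (hf.conjugate.le_one hu),
    ← ENNReal.ofReal_mul (hh.pos ht).le, ← ENNReal.ofReal_mul (hf.pos hu).le]
  rcases le_total (u / f u + t / h t - 1) 0 with hn | hn
  · rw [max_eq_left hn, mul_zero, ENNReal.ofReal_zero, ENNReal.ofReal_eq_zero, ← mul_assoc]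
    exact mul_nonpos_of_nonneg_of_nonpos (mul_pos (hf.pos hu) (hh.pos ht)).le (by linarith)
  · rw [max_eq_right hn]
    congr 1
    ring

lemma shockLaw_maxLifetime_fst_le (hf : IsSubhomogeneous f) {u : ℝ} (hu : u ∈ Ioc (0 : ℝ) 1) :
    shockLaw {ω | maxLifetime f ω.1 ω.2.2 ≤ u} = ENNReal.ofReal u := by
  -- At `t = 1` the second condition is vacuous, so any second generator gives the marginal.
  have := hf.shockLaw_maxLifetime_le hf hu (right_mem_Ioc.2 one_pos)
  simp only [hf.maxLifetime_le_one, and_true, hf.one, div_one, mul_one, add_sub_cancel_right,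
    max_eq_right (hf.conjugate.pos hu).le, mul_div_cancel₀ _ (hf.pos hu).ne'] at this
  exact this

lemma shockLaw_maxLifetime_snd_le (hh : IsSubhomogeneous h) {t : ℝ} (ht : t ∈ Ioc (0 : ℝ) 1) :
    shockLaw {ω | maxLifetime h ω.2.1 (1 - ω.2.2) ≤ t} = ENNReal.ofReal t := by
  have := hh.shockLaw_maxLifetime_le hh (right_mem_Ioc.2 one_pos) ht
  simp only [hh.maxLifetime_le_one, true_and, hh.one, div_one, one_mul, add_sub_cancel_left,
    max_eq_right (hh.conjugate.pos ht).le, mul_div_cancel₀ _ (hh.pos ht).ne'] at this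
  exact this

end IsSubhomogeneous

lemma ae_pos_of_measure_le {Ω : Type*} [MeasurableSpace Ω] {P : Measure Ω} {X : Ω → ℝ}
    (hX : ∀ u ∈ Ioc (0 : ℝ) 1, P {ω | X ω ≤ u} = ENNReal.ofReal u) : ∀ᵐ ω ∂P, 0 < X ω := by
  simp only [ae_iff, not_lt]
  by_contra hne
  obtain ⟨r, hr, hr'⟩ := ENNReal.lt_iff_exists_real_btwn.1 (pos_iff_ne_zero.2 hne)
  have hr0 : 0 < r := by
    by_contra! hr0
    rw [ENNReal.ofReal_of_nonpos hr0] at hr'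
    exact lt_irrefl _ hr'.1
  have hmin : min r 1 ∈ Ioc (0 : ℝ) 1 := ⟨lt_min hr0 one_pos, min_le_right _ _⟩
  have h1 : P {ω | X ω ≤ 0} ≤ ENNReal.ofReal (min r 1) := by
    rw [← hX _ hmin]
    exact measure_mono fun ω hω => le_trans hω hmin.1.le
  exact (h1.trans (ENNReal.ofReal_le_ofReal (min_le_left _ _))).not_gt hr'.2

namespace IsSubhomogeneous

variable {f h : ℝ → ℝ}

lemma ae_maxLifetime_fst_pos (hf : IsSubhomogeneous f) :
    ∀ᵐ ω ∂shockLaw, 0 < maxLifetime f ω.1 ω.2.2 :=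
  ae_pos_of_measure_le fun _ hu => hf.shockLaw_maxLifetime_fst_le hu

lemma ae_maxLifetime_snd_pos (hh : IsSubhomogeneous h) :
    ∀ᵐ ω ∂shockLaw, 0 < maxLifetime h ω.2.1 (1 - ω.2.2) :=
  ae_pos_of_measure_le fun _ hu => hh.shockLaw_maxLifetime_snd_le hu

/-- A positive value `t` is attained only if Y = h(t) or 1 - Z = t/h(t), each of probability zero.
-/
lemma ae_maxLifetime_snd_ne (hh : IsSubhomogeneous h) {t : ℝ} (ht : 0 < t) :
    ∀ᵐ ω ∂shockLaw, maxLifetime h ω.2.1 (1 - ω.2.2) ≠ t := by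
  have hs (a : ℝ) : ∀ᵐ x ∂unitUniform, x ≠ a :=
    measure_eq_zero_iff_ae_notMem.1 (unitUniform_singleton a)
  filter_upwards [ae_shock_mem,
    measurePreserving_shock_snd.quasiMeasurePreserving.ae (hs (h t)),
    measurePreserving_shock_reflect.quasiMeasurePreserving.ae (hs (t / h t))] with ω hω h1 h2 heq
  rcases max_choice (unitInverse h ω.2.1) (unitInverse (fun u => u / h u) (1 - ω.2.2)) with hm | hm
  · have hY : unitInverse h ω.2.1 = t := hm.symm.trans heq
    have := hh.apply_unitInverse hω.2.1.2.le (hY ▸ ht)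
    exact h1 (by rw [← this, hY])
  · have hY : unitInverse (fun u => u / h u) (1 - ω.2.2) = t := hm.symm.trans heq
    have := hh.conjugate.apply_unitInverse (by linarith [hω.2.2.1]) (hY ▸ ht)
    exact h2 (by rw [← this, hY])

/-- On a Lebesgue null set, almost surely both lifetimes are caused by the common shock. -/
lemma ae_lt_of_maxLifetime_mem (hf : IsSubhomogeneous f) (hh : IsSubhomogeneous h)
    {N : Set (ℝ × ℝ)} (hN : volume N = 0) :
    ∀ᵐ ω ∂shockLaw, (maxLifetime f ω.1 ω.2.2, maxLifetime h ω.2.1 (1 - ω.2.2)) ∈ N →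
      unitInverse f ω.1 < unitInverse (fun u => u / f u) ω.2.2 ∧
      unitInverse h ω.2.1 < unitInverse (fun u => u / h u) (1 - ω.2.2) := by
  filter_upwards [hf.ae_maxLifetime_fst_pos, hh.ae_maxLifetime_snd_pos,
    measurePreserving_shock_fst_snd.quasiMeasurePreserving.ae
      (hf.ae_unitInverse_pair_notMem hh hN),
    measurePreserving_shock_fst_reflect.quasiMeasurePreserving.ae
      (hf.ae_unitInverse_pair_notMem hh.conjugate hN),
    measurePreserving_shock_common_snd.quasiMeasurePreserving.ae
      (hf.conjugate.ae_unitInverse_pair_notMem hh hN)] with ω hU hT h1 h2 h3 hmem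
  unfold maxLifetime at hU hT hmem
  -- In every case but the first, the two maxima are attained at independent shocks.
  rcases lt_or_ge (unitInverse f ω.1) (unitInverse (fun u => u / f u) ω.2.2) with hx | hx <;>
  rcases lt_or_ge (unitInverse h ω.2.1) (unitInverse (fun u => u / h u) (1 - ω.2.2)) with hy | hy
  · exact ⟨hx, hy⟩
  · rw [max_eq_right hx.le] at hU hmem
    rw [max_eq_left hy] at hT hmem
    exact absurd hmem (h3 hU hT)
  · rw [max_eq_left hx] at hU hmem
    rw [max_eq_right hy.le] at hT hmem
    exact absurd hmem (h2 hU hT)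
  · rw [max_eq_left hx] at hU hmem
    rw [max_eq_left hy] at hT hmem
    exact absurd hmem (h1 hU hT)

end IsSubhomogeneous

/-! ### From generators to the shock model -/

/-- The reflection `t ↦ 1 - ψ(1 - t)` of a generator. -/
def reflectGenerator (ψ : ℝ → ℝ) (t : ℝ) : ℝ := 1 - ψ (1 - t)

namespace IsMaxminGenerators

variable {φ ψ : ℝ → ℝ}

lemma isSubhomogeneous_phi (H : IsMaxminGenerators φ ψ) : IsSubhomogeneous φ where
  mono := H.phi_mono.mono Ioc_subset_Icc_self
  anti := H.phiStar_anti
  one := H.phi_one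

lemma psi_le_self (H : IsMaxminGenerators φ ψ) {v : ℝ} (hv : v ∈ Icc (0 : ℝ) 1) : ψ v ≤ v := by
  rcases hv.1.eq_or_lt with rfl | h0
  · exact H.psi_zero.le
  rcases hv.2.eq_or_lt with rfl | h1
  · exact H.psi_one.le
  by_contra! hlt
  have h := H.one_le_psiStar v ⟨h0, h1⟩
  rw [psiStar, if_neg hlt.ne'] at h
  have h' : (1 : ℝ) ≤ (1 - ψ v) / (v - ψ v) := by exact_mod_cast h
  have h2 : ψ v ≤ 1 := H.psi_one ▸ H.psi_mono hv (right_mem_Icc.2 zero_le_one) hv.2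
  have := div_nonpos_of_nonneg_of_nonpos (sub_nonneg.2 h2) (sub_nonpos.2 hlt.le)
  linarith

/-- With `a = 1 - ψ(v)` and `b = 1 - v`, `ψ_* = a/(a - b) = 1/(1 - b/a)`, so `b/a` is nonincreasing
along with `ψ_*`. -/
lemma psi_mul_le (H : IsMaxminGenerators φ ψ) {v w : ℝ} (hv : v ∈ Ioo (0 : ℝ) 1)
    (hw : w ∈ Ioo (0 : ℝ) 1) (hvw : v ≤ w) : (1 - ψ v) * (1 - w) ≤ (1 - ψ w) * (1 - v) := by
  have h := H.psiStar_anti hv hw hvw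
  have hv' := H.psi_le_self (Ioo_subset_Icc_self hv)
  have hw' := H.psi_le_self (Ioo_subset_Icc_self hw)
  by_cases hwe : ψ w = w
  · by_cases hve : ψ v = v
    · rw [hwe, hve, mul_comm]
    · rw [psiStar, if_pos hwe, psiStar, if_neg hve, top_le_iff] at h
      exact absurd h (EReal.coe_ne_top _)
  · by_cases hve : ψ v = v
    · rw [hve]
      nlinarith [hv.2]
    · rw [psiStar, if_neg hwe, psiStar, if_neg hve, EReal.coe_le_coe_iff,
        div_le_div_iff₀ (sub_pos.2 (lt_of_le_of_ne hw' hwe))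
          (sub_pos.2 (lt_of_le_of_ne hv' hve))] at h
      nlinarith

lemma isSubhomogeneous_reflectGenerator (H : IsMaxminGenerators φ ψ) :
    IsSubhomogeneous (reflectGenerator ψ) where
  mono s hs t ht hst := by
    have := H.psi_mono (a := 1 - t) (b := 1 - s) ⟨by linarith [ht.2], by linarith [ht.1]⟩
      ⟨by linarith [hs.2], by linarith [hs.1]⟩ (by linarith)
    simp only [reflectGenerator]
    linarith
  anti s hs t ht hst := by
    simp only [reflectGenerator]
    rw [div_le_div_iff₀ ht.1 hs.1]
    rcases ht.2.eq_or_lt with rfl | ht1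
    · have := H.psi_le_self (v := 1 - s) ⟨by linarith [hs.2], by linarith [hs.1]⟩
      simp only [sub_self, H.psi_zero]
      linarith
    · have := H.psi_mul_le (v := 1 - t) (w := 1 - s) ⟨by linarith, by linarith [ht.1]⟩
        ⟨by linarith, by linarith [hs.1]⟩ (by linarith)
      simpa using this
  one := by simp [reflectGenerator, H.psi_zero]

end IsMaxminGenerators

/-! ### Existence of the copula measure -/

/-- The joint law of a maximum and a minimum of two own shocks with a common shock. -/
noncomputable def maxminMeasure (φ ψ : ℝ → ℝ) : Measure (ℝ × ℝ) :=
  shockLaw.map fun ω =>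
    (maxLifetime φ ω.1 ω.2.2, 1 - maxLifetime (reflectGenerator ψ) ω.2.1 (1 - ω.2.2))

lemma measurable_maxLifetime_pair {f h : ℝ → ℝ} (hf : IsSubhomogeneous f)
    (hh : IsSubhomogeneous h) : Measurable fun ω : ℝ × ℝ × ℝ =>
      (maxLifetime f ω.1 ω.2.2, 1 - maxLifetime h ω.2.1 (1 - ω.2.2)) := by
  have h1 := hf.measurable_maxLifetime.comp
    (measurable_fst.prodMk (measurable_snd.comp measurable_snd) :
      Measurable fun ω : ℝ × ℝ × ℝ => (ω.1, ω.2.2))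
  have h2 := hh.measurable_maxLifetime.comp
    ((measurable_fst.comp measurable_snd).prodMk
      (measurable_const.sub (measurable_snd.comp measurable_snd)) :
      Measurable fun ω : ℝ × ℝ × ℝ => (ω.2.1, 1 - ω.2.2))
  exact h1.prodMk (measurable_const.sub h2)

lemma shockLaw_real_maxLifetime_rect {f h : ℝ → ℝ} (hf : IsSubhomogeneous f)
    (hh : IsSubhomogeneous h) {u t : ℝ} (hu : u ∈ Ioc (0 : ℝ) 1) (ht : t ∈ Ioc (0 : ℝ) 1) :
    shockLaw.real {ω | maxLifetime f ω.1 ω.2.2 ≤ u ∧ t ≤ maxLifetime h ω.2.1 (1 - ω.2.2)} =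
      min u (f u * (h t - t) + u * (1 - h t)) := by
  have hm : MeasurableSet {ω : ℝ × ℝ × ℝ | maxLifetime h ω.2.1 (1 - ω.2.2) ≤ t} := by
    have := (measurable_maxLifetime_pair hf hh).snd (measurableSet_Ici (a := 1 - t))
    convert this using 1
    ext ω
    change _ ≤ t ↔ 1 - t ≤ 1 - _
    rw [sub_le_sub_iff_left]
  have h1 := measureReal_inter_add_sdiff (μ := shockLaw)
    (s := {ω : ℝ × ℝ × ℝ | maxLifetime f ω.1 ω.2.2 ≤ u}) hm
  have h2 : shockLaw.real ({ω : ℝ × ℝ × ℝ | maxLifetime f ω.1 ω.2.2 ≤ u} \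
      {ω | maxLifetime h ω.2.1 (1 - ω.2.2) ≤ t}) =
      shockLaw.real {ω | maxLifetime f ω.1 ω.2.2 ≤ u ∧ t ≤ maxLifetime h ω.2.1 (1 - ω.2.2)} := by
    refine measureReal_congr ?_
    filter_upwards [hh.ae_maxLifetime_snd_ne ht.1] with ω hω
    refine propext (and_congr_right fun _ => ?_)
    exact ⟨fun h => (not_le.1 h).le, fun h => not_le.2 (lt_of_le_of_ne h hω.symm)⟩
  rw [← ofPred_and, measureReal_def shockLaw {ω | _ ∧ _}, hf.shockLaw_maxLifetime_le hh hu ht,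
    measureReal_def shockLaw {ω | _ ≤ u}, hf.shockLaw_maxLifetime_fst_le hu, h2,
    ENNReal.toReal_ofReal (mul_nonneg (mul_pos (hf.pos hu) (hh.pos ht)).le (le_max_left _ _)),
    ENNReal.toReal_ofReal hu.1.le] at h1
  have h3 : f u * h t * max 0 (u / f u + t / h t - 1) = max 0 (u * h t + f u * t - f u * h t) := by
    rw [mul_max_of_nonneg _ _ (mul_pos (hf.pos hu) (hh.pos ht)).le, mul_zero]
    have := (hf.pos hu).ne'
    have := (hh.pos ht).ne'
    congr 1
    field_simp
  rw [h3] at h1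
  have h4 : u - max 0 (u * h t + f u * t - f u * h t) =
      min u (f u * (h t - t) + u * (1 - h t)) := by
    rw [← min_sub_sub_left, sub_zero]
    congr 1
    ring
  linarith

lemma IsMaxminGenerators.isCopulaMeasure {φ ψ : ℝ → ℝ} (H : IsMaxminGenerators φ ψ) :
    IsCopulaMeasure (maxminFun φ ψ) (maxminMeasure φ ψ) := by
  have hf := H.isSubhomogeneous_phi
  have hh := H.isSubhomogeneous_reflectGenerator
  have hmeas := measurable_maxLifetime_pair hf hh
  have hprob : IsProbabilityMeasure (maxminMeasure φ ψ) :=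
    Measure.isProbabilityMeasure_map hmeas.aemeasurable
  have hbd : ∀ ω : ℝ × ℝ × ℝ, 0 ≤ maxLifetime (reflectGenerator ψ) ω.2.1 (1 - ω.2.2) ∧
      maxLifetime (reflectGenerator ψ) ω.2.1 (1 - ω.2.2) ≤ 1 := fun ω =>
    ⟨maxLifetime_nonneg _ _ _, hh.maxLifetime_le_one _ _⟩
  refine ⟨hprob, ?_, fun u hu v hv => ?_⟩
  · rw [maxminMeasure, Measure.map_apply hmeas (measurableSet_Icc.prod measurableSet_Icc).compl]
    convert measure_empty (μ := shockLaw)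
    refine eq_empty_of_forall_notMem fun ω hω => hω ?_
    exact ⟨⟨maxLifetime_nonneg _ _ _, hf.maxLifetime_le_one _ _⟩,
      by linarith [(hbd ω).2], by linarith [(hbd ω).1]⟩
  · have hset : (maxminMeasure φ ψ).real (Icc 0 u ×ˢ Icc 0 v) =
        shockLaw.real {ω | maxLifetime φ ω.1 ω.2.2 ≤ u ∧
          1 - v ≤ maxLifetime (reflectGenerator ψ) ω.2.1 (1 - ω.2.2)} := by
      rw [maxminMeasure, map_measureReal_apply hmeas (measurableSet_Icc.prod measurableSet_Icc)]
      congr 1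
      ext ω
      change (0 ≤ _ ∧ _ ≤ u) ∧ (0 ≤ 1 - _ ∧ 1 - _ ≤ v) ↔ _ ∧ _
      constructor
      · rintro ⟨⟨_, h1⟩, _, h2⟩
        exact ⟨h1, by linarith⟩
      · rintro ⟨h1, h2⟩
        exact ⟨⟨maxLifetime_nonneg _ _ _, h1⟩, by linarith [(hbd ω).2], by linarith⟩
    rw [hset]
    -- The edges `u = 0` and `v = 1` (where `t = 1 - v = 0`) lie outside the range of the rectangle
    -- formula.
    rcases hu.1.eq_or_lt with rfl | hu0
    · have h0 : shockLaw {ω | maxLifetime φ ω.1 ω.2.2 ≤ 0 ∧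
          1 - v ≤ maxLifetime (reflectGenerator ψ) ω.2.1 (1 - ω.2.2)} = 0 := by
        refine measure_mono_null (t := {ω | ¬ 0 < maxLifetime φ ω.1 ω.2.2})
          (fun ω hω => not_lt.2 hω.1) hf.ae_maxLifetime_fst_pos
      rw [measureReal_def, h0]
      simp [maxminFun, H.phi_zero]
    rcases hv.2.eq_or_lt with rfl | hv1
    · simp only [sub_self, (hbd _).1, and_true]
      rw [measureReal_def, hf.shockLaw_maxLifetime_fst_le ⟨hu0, hu.2⟩,
        ENNReal.toReal_ofReal hu.1]
      simp [maxminFun, H.psi_one]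
    · rw [shockLaw_real_maxLifetime_rect hf hh ⟨hu0, hu.2⟩ ⟨sub_pos.2 hv1, by linarith [hv.1]⟩,
        maxminFun, reflectGenerator, sub_sub_cancel]
      congr 1
      ring

/-! ### Uniqueness of the copula measure -/

namespace IsCopulaMeasure

variable {C D : ℝ → ℝ → ℝ} {μ ν : Measure (ℝ × ℝ)}

lemma congr (h : IsCopulaMeasure C μ)
    (hCD : ∀ u ∈ Icc (0 : ℝ) 1, ∀ v ∈ Icc (0 : ℝ) 1, C u v = D u v) : IsCopulaMeasure D μ :=
  ⟨h.1, h.2, fun u hu v hv => (h.3 u hu v hv).trans (hCD u hu v hv)⟩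

lemma measure_Iic_prod (h : IsCopulaMeasure C μ) (u v : ℝ) :
    μ (Iic u ×ˢ Iic v) = μ (Icc 0 (min u 1) ×ˢ Icc 0 (min v 1)) := by
  have hs : ∀ᵐ p ∂μ, p ∈ Icc (0 : ℝ) 1 ×ˢ Icc (0 : ℝ) 1 := h.compl_square
  refine measure_congr ?_
  filter_upwards [hs] with p hp
  refine propext ?_
  change (p.1 ≤ u ∧ p.2 ≤ v) ↔ ((0 ≤ p.1 ∧ p.1 ≤ min u 1) ∧ (0 ≤ p.2 ∧ p.2 ≤ min v 1))
  obtain ⟨⟨h1, h2⟩, h3, h4⟩ := hp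
  simp only [le_min_iff]
  tauto

lemma measure_Iic_prod_eq (hμ : IsCopulaMeasure C μ) (hν : IsCopulaMeasure C ν) (u v : ℝ) :
    μ (Iic u ×ˢ Iic v) = ν (Iic u ×ˢ Iic v) := by
  have := hμ.isProbabilityMeasure
  have := hν.isProbabilityMeasure
  rw [hμ.measure_Iic_prod, hν.measure_Iic_prod]
  rcases lt_or_ge u 0 with hu | hu
  · rw [Icc_eq_empty (fun h => (h.trans (min_le_left _ _)).not_gt hu)]
    simp
  rcases lt_or_ge v 0 with hv | hv
  · rw [Icc_eq_empty (fun h : 0 ≤ min v 1 => (h.trans (min_le_left _ _)).not_gt hv)]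
    simp
  rw [← measureReal_eq_measureReal_iff]
  rw [hμ.real_rect _ ⟨le_min hu zero_le_one, min_le_right _ _⟩ _
    ⟨le_min hv zero_le_one, min_le_right _ _⟩, hν.real_rect _ ⟨le_min hu zero_le_one,
    min_le_right _ _⟩ _ ⟨le_min hv zero_le_one, min_le_right _ _⟩]

/-- Agreement on quadrants is extended one coordinate at a time: first half-lines in the first
coordinate become measurable sets, then those in the second. -/
lemma unique (hμ : IsCopulaMeasure C μ) (hν : IsCopulaMeasure C ν) : μ = ν := by
  have := hμ.isProbabilityMeasure
  have := hν.isProbabilityMeasure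
  have h1 (v : ℝ) : (μ.restrict (univ ×ˢ Iic v)).map Prod.fst =
      (ν.restrict (univ ×ˢ Iic v)).map Prod.fst := by
    refine Measure.ext_of_Iic _ _ fun u => ?_
    rw [Measure.map_apply measurable_fst measurableSet_Iic,
      Measure.map_apply measurable_fst measurableSet_Iic,
      Measure.restrict_apply (measurable_fst measurableSet_Iic),
      Measure.restrict_apply (measurable_fst measurableSet_Iic), ← prod_univ, prod_inter_prod,
      inter_univ, univ_inter]
    exact hμ.measure_Iic_prod_eq hν u v
  refine Measure.ext_prod fun {s t} hs ht => ?_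
  have h2 : (μ.restrict (s ×ˢ univ)).map Prod.snd = (ν.restrict (s ×ˢ univ)).map Prod.snd := by
    refine Measure.ext_of_Iic _ _ fun v => ?_
    have h3 := DFunLike.congr_fun (h1 v) s
    rw [Measure.map_apply measurable_fst hs, Measure.map_apply measurable_fst hs,
      Measure.restrict_apply (measurable_fst hs), Measure.restrict_apply (measurable_fst hs),
      ← prod_univ, prod_inter_prod, inter_univ, univ_inter] at h3
    rw [Measure.map_apply measurable_snd measurableSet_Iic,
      Measure.map_apply measurable_snd measurableSet_Iic,
      Measure.restrict_apply (measurable_snd measurableSet_Iic),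
      Measure.restrict_apply (measurable_snd measurableSet_Iic), ← univ_prod, prod_inter_prod,
      inter_univ, univ_inter]
    exact h3
  have h3 := DFunLike.congr_fun h2 t
  rw [Measure.map_apply measurable_snd ht, Measure.map_apply measurable_snd ht,
    Measure.restrict_apply (measurable_snd ht), Measure.restrict_apply (measurable_snd ht),
    ← univ_prod, prod_inter_prod, inter_univ, univ_inter] at h3
  exact h3

end IsCopulaMeasure

/-! ### The singular component -/

lemma measurePreserving_reflect_snd :
    MeasurePreserving (fun p : ℝ × ℝ => (p.1, 1 - p.2)) volume volume :=
  (MeasurePreserving.id (volume : Measure ℝ)).prod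
    (Measure.measurePreserving_sub_left (volume : Measure ℝ) 1)

lemma IsSubhomogeneous.eq_one_of_ae_lt {f : ℝ → ℝ} (hf : IsSubhomogeneous f)
    {X Z : ℝ × ℝ × ℝ → ℝ} (hZ : MeasurePreserving Z shockLaw unitUniform)
    (hU : ∀ u ∈ Ioc (0 : ℝ) 1, shockLaw {ω | maxLifetime f (X ω) (Z ω) ≤ u} = ENNReal.ofReal u)
    (hlt : ∀ᵐ ω ∂shockLaw, unitInverse f (X ω) < unitInverse (fun u => u / f u) (Z ω))
    {u : ℝ} (hu : u ∈ Ioc (0 : ℝ) 1) : f u = 1 := by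
  have h1 : shockLaw {ω | maxLifetime f (X ω) (Z ω) ≤ u} = shockLaw (Z ⁻¹' Iic (u / f u)) := by
    refine measure_congr ?_
    filter_upwards [hlt, hZ.quasiMeasurePreserving.ae ae_unitUniform] with ω hω hz
    refine propext ?_
    change maxLifetime f (X ω) (Z ω) ≤ u ↔ Z ω ≤ u / f u
    rw [maxLifetime, max_eq_right hω.le, hf.conjugate.unitInverse_le_iff hu hz.2.le]
  rw [hU u hu, hZ.measure_preimage measurableSet_Iic.nullMeasurableSet,
    unitUniform_Iic (hf.conjugate.le_one hu), ENNReal.ofReal_eq_ofReal_iff hu.1.le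
      (hf.conjugate.pos hu).le, eq_div_iff (hf.pos hu).ne', mul_eq_left₀ hu.1.ne'] at h1
  exact h1

lemma mem_maxminCurve_iff {φ ψ : ℝ → ℝ} {u v : ℝ} :
    (u, v) ∈ maxminCurve φ ψ ↔ u ∈ Ioc (0 : ℝ) 1 ∧ v ∈ Ioo (0 : ℝ) 1 ∧
      φ u * (v - ψ v) = (1 - ψ v) * u := by
  refine and_congr_right fun hu => and_congr_right fun hv => ?_
  change ((phiStar φ u : ℝ) : EReal) = psiStar ψ v ↔ _
  by_cases hve : ψ v = v
  -- If `ψ v = v`, both sides fail: `φ*(u)` is finite, and `(1 - v) u > 0`.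
  · rw [psiStar, if_pos hve, hve, sub_self, mul_zero]
    exact ⟨fun h => absurd h (EReal.coe_ne_top _),
      fun h => absurd h (mul_pos (sub_pos.2 hv.2) hu.1).ne⟩
  · rw [psiStar, if_neg hve, EReal.coe_eq_coe_iff, phiStar,
      div_eq_div_iff hu.1.ne' (sub_ne_zero.2 (Ne.symm hve))]

namespace IsMaxminGenerators

variable {φ ψ : ℝ → ℝ}

lemma measurableSet_maxminCurve (H : IsMaxminGenerators φ ψ) :
    MeasurableSet (maxminCurve φ ψ) := by
  -- The generators are arbitrary off [0,1], so monotone extensions are used to get measurability.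
  have hext : ∀ f : ℝ → ℝ, MonotoneOn f (Icc 0 1) → ∃ g : ℝ → ℝ, Monotone g ∧
      EqOn f g (Icc 0 1) := fun f hf => hf.exists_monotone_extension
    (hf.map_bddBelow subset_rfl ⟨0, fun _ h => h.1, left_mem_Icc.2 zero_le_one⟩)
    (hf.map_bddAbove subset_rfl ⟨1, fun _ h => h.2, right_mem_Icc.2 zero_le_one⟩)
  obtain ⟨φ', hφ', hφe⟩ := hext φ H.phi_mono
  obtain ⟨ψ', hψ', hψe⟩ := hext ψ H.psi_mono
  have hset : maxminCurve φ ψ = (Ioc 0 1 ×ˢ Ioo 0 1) ∩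
      {p | φ' p.1 * (p.2 - ψ' p.2) = (1 - ψ' p.2) * p.1} := by
    ext ⟨u, v⟩
    rw [mem_maxminCurve_iff, ← and_assoc]
    refine and_congr_right fun ⟨hu, hv⟩ => ?_
    change _ ↔ φ' u * (v - ψ' v) = (1 - ψ' v) * u
    rw [hφe (Ioc_subset_Icc_self hu), hψe (Ioo_subset_Icc_self hv)]
  rw [hset]
  have h1 := hφ'.measurable
  have h2 := hψ'.measurable
  exact (measurableSet_Ioc.prod measurableSet_Ioo).inter
    (measurableSet_eq_fun (by fun_prop) (by fun_prop))

lemma ae_lt_of_mem (H : IsMaxminGenerators φ ψ) {N : Set (ℝ × ℝ)} (hN : volume N = 0) :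
    ∀ᵐ ω ∂shockLaw,
      (maxLifetime φ ω.1 ω.2.2, 1 - maxLifetime (reflectGenerator ψ) ω.2.1 (1 - ω.2.2)) ∈ N →
      unitInverse φ ω.1 < unitInverse (fun u => u / φ u) ω.2.2 ∧
      unitInverse (reflectGenerator ψ) ω.2.1 <
        unitInverse (fun t => t / reflectGenerator ψ t) (1 - ω.2.2) :=
  H.isSubhomogeneous_phi.ae_lt_of_maxLifetime_mem H.isSubhomogeneous_reflectGenerator
    (measurePreserving_reflect_snd.quasiMeasurePreserving.preimage_null hN)

lemma maxminMeasure_diff_maxminCurve (H : IsMaxminGenerators φ ψ) {N : Set (ℝ × ℝ)}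
    (hNm : MeasurableSet N) (hN : volume N = 0) :
    maxminMeasure φ ψ (N \ maxminCurve φ ψ) = 0 := by
  have hf := H.isSubhomogeneous_phi
  have hh := H.isSubhomogeneous_reflectGenerator
  rw [maxminMeasure, Measure.map_apply (measurable_maxLifetime_pair hf hh)
    (hNm.diff H.measurableSet_maxminCurve), measure_eq_zero_iff_ae_notMem]
  filter_upwards [H.ae_lt_of_mem hN, ae_shock_mem, hf.ae_maxLifetime_fst_pos,
    hh.ae_maxLifetime_snd_pos, hh.ae_maxLifetime_snd_ne one_pos] with ω hω hmem hU hT hT1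
  rintro ⟨hωN, hωC⟩
  obtain ⟨hx, hy⟩ := hω hωN
  refine hωC ?_
  have hU1 := hf.maxLifetime_le_one ω.1 ω.2.2
  have hT1' := lt_of_le_of_ne (hh.maxLifetime_le_one ω.2.1 (1 - ω.2.2)) hT1
  rw [mem_maxminCurve_iff]
  refine ⟨⟨hU, hU1⟩, ⟨sub_pos.2 hT1', by linarith⟩, ?_⟩
  unfold maxLifetime at *
  rw [max_eq_right hx.le] at *
  rw [max_eq_right hy.le] at *
  have h1 := hf.conjugate.apply_unitInverse hmem.2.2.2.le hU
  have h2 := hh.conjugate.apply_unitInverse (by linarith [hmem.2.2.1]) hT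
  set s := unitInverse (fun u => u / φ u) ω.2.2
  set t := unitInverse (fun t => t / reflectGenerator ψ t) (1 - ω.2.2)
  rw [div_eq_iff (hf.pos ⟨hU, hU1⟩).ne'] at h1
  rw [div_eq_iff (hh.pos ⟨hT, hT1'.le⟩).ne', reflectGenerator] at h2
  linear_combination (-(1 - ψ (1 - t))) * h1 - φ s * h2

lemma singularPart_compl_maxminCurve (H : IsMaxminGenerators φ ψ) :
    (maxminMeasure φ ψ).singularPart volume (maxminCurve φ ψ)ᶜ = 0 := by
  obtain ⟨s, hs, hs0, hsc⟩ := Measure.mutuallySingular_singularPart (maxminMeasure φ ψ) volume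
  refine measure_mono_null (t := s ∪ (sᶜ \ maxminCurve φ ψ)) (fun p hp => ?_)
    (measure_union_null hs0 ?_)
  · by_cases hps : p ∈ s
    · exact Or.inl hps
    · exact Or.inr ⟨hps, hp⟩
  · exact nonpos_iff_eq_zero.1 ((Measure.singularPart_le _ _ _).trans
      (H.maxminMeasure_diff_maxminCurve hs.compl hsc).le)

lemma eq_min_of_mutuallySingular (H : IsMaxminGenerators φ ψ)
    (hsing : maxminMeasure φ ψ ⟂ₘ volume) {u v : ℝ} (hu : u ∈ Icc (0 : ℝ) 1)
    (hv : v ∈ Icc (0 : ℝ) 1) : maxminFun φ ψ u v = min u v := by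
  have hf := H.isSubhomogeneous_phi
  have hh := H.isSubhomogeneous_reflectGenerator
  obtain ⟨s, hs, hs0, hsc⟩ := hsing
  rw [maxminMeasure, Measure.map_apply (measurable_maxLifetime_pair hf hh) hs,
    measure_eq_zero_iff_ae_notMem] at hs0
  have hae := H.ae_lt_of_mem hsc
  have hphi : ∀ w ∈ Ioc (0 : ℝ) 1, φ w = 1 := fun w hw =>
    hf.eq_one_of_ae_lt (X := fun ω => ω.1) measurePreserving_shock_common
      (fun _ h => hf.shockLaw_maxLifetime_fst_le h)
      (by filter_upwards [hs0, hae] with ω h1 h2 using (h2 h1).1) hw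
  have hpsi : ∀ w ∈ Ioc (0 : ℝ) 1, reflectGenerator ψ w = 1 := fun w hw =>
    hh.eq_one_of_ae_lt (X := fun ω => ω.2.1) measurePreserving_shock_reflect
      (fun _ h => hh.shockLaw_maxLifetime_snd_le h)
      (by filter_upwards [hs0, hae] with ω h1 h2 using (h2 h1).2) hw
  rcases hu.1.eq_or_lt with rfl | hu0
  · simp [maxminFun, H.phi_zero, hv.1]
  rcases hv.2.eq_or_lt with rfl | hv1
  · simp [maxminFun, H.psi_one, hu.2]
  have h2 := hpsi (1 - v) ⟨by linarith, by linarith [hv.1]⟩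
  simp only [reflectGenerator, sub_sub_cancel, sub_eq_self] at h2
  simp [maxminFun, hphi u ⟨hu0, hu.2⟩, h2]

end IsMaxminGenerators

/-! ### The Fréchet–Hoeffding upper bound -/

/-- Generators of the Fréchet–Hoeffding upper bound. -/
lemma isMaxminGenerators_upperBound :
    IsMaxminGenerators (fun u => if u ≤ 0 then 0 else 1) (fun v => if v < 1 then 0 else 1) := by
  have hpsi : ∀ v ∈ Ioo (0 : ℝ) 1,
      psiStar (fun v => if v < 1 then 0 else 1) v = ((1 / v : ℝ) : EReal) := fun v hv => by
    simp [psiStar, hv.2, hv.1.ne]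
  have hphi : ∀ u ∈ Ioc (0 : ℝ) 1, phiStar (fun u => if u ≤ 0 then 0 else 1) u = 1 / u :=
    fun u hu => by simp [phiStar, hu.1.not_ge]
  refine ⟨by simp, by simp, by simp, by simp, fun u _ v _ huv => ?_, fun u _ v _ huv => ?_,
    fun u hu => ?_, fun v hv => ?_, fun u hu v hv huv => ?_, fun u hu v hv huv => ?_⟩
  · split_ifs <;> linarith
  · split_ifs <;> linarith
  · rw [hphi u hu]
    exact (one_le_div hu.1).2 hu.2
  · rw [hpsi v hv]
    exact_mod_cast (one_le_div hv.1).2 hv.2.le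
  · rw [hphi u hu, hphi v hv]
    exact one_div_le_one_div_of_le hu.1 huv
  · rw [hpsi u hu, hpsi v hv, EReal.coe_le_coe_iff]
    exact one_div_le_one_div_of_le hu.1 huv

lemma isMaxminCopula_min : IsMaxminCopula min := by
  refine ⟨_, _, isMaxminGenerators_upperBound, fun u hu v hv => ?_⟩
  rcases hu.1.eq_or_lt with rfl | hu0
  · simp [maxminFun, hv.1]
  rcases hv.2.eq_or_lt with rfl | hv1
  · simp [maxminFun, hu.2]
  · simp [maxminFun, hv1, hu0.not_ge]

lemma isFullySingular_min : IsFullySingular min := by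
  have hm : Measurable fun x : ℝ => (x, x) := measurable_id.prodMk measurable_id
  refine ⟨unitUniform.map fun x => (x, x), ⟨Measure.isProbabilityMeasure_map hm.aemeasurable,
    ?_, fun u hu v hv => ?_⟩, ?_⟩
  · rw [Measure.map_apply hm (measurableSet_Icc.prod measurableSet_Icc).compl,
      measure_eq_zero_iff_ae_notMem]
    filter_upwards [ae_unitUniform] with x hx h
    exact h ⟨Ioo_subset_Icc_self hx, Ioo_subset_Icc_self hx⟩
  · rw [map_measureReal_apply hm (measurableSet_Icc.prod measurableSet_Icc)]
    have : (fun x : ℝ => (x, x)) ⁻¹' (Icc 0 u ×ˢ Icc 0 v) = Icc 0 (min u v) := by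
      ext x
      change (_ ∧ _) ∧ (_ ∧ _) ↔ (_ ∧ _)
      rw [le_min_iff]
      tauto
    rw [this, measureReal_def, unitUniform_Icc le_rfl ((min_le_left _ _).trans hu.2), sub_zero,
      ENNReal.toReal_ofReal (le_min hu.1 hv.1)]
  · have hd : MeasurableSet (diagonal ℝ) := isClosed_diagonal.measurableSet
    refine ⟨(diagonal ℝ)ᶜ, hd.compl, ?_, ?_⟩
    · rw [Measure.map_apply hm hd.compl]
      convert measure_empty (μ := unitUniform)
      exact eq_empty_of_forall_notMem fun x hx => hx rfl
    · rw [compl_compl, Measure.volume_eq_prod, Measure.measure_prod_null hd]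
      refine Filter.Eventually.of_forall fun x => ?_
      have : Prod.mk x ⁻¹' diagonal ℝ = {x} := by
        ext y
        exact eq_comm
      simp [this]

theorem mainTheorem5 :
    (∀ φ ψ : ℝ → ℝ, IsMaxminGenerators φ ψ →
      (∃! μ : Measure (ℝ × ℝ), IsCopulaMeasure (maxminFun φ ψ) μ) ∧
      ∀ μ : Measure (ℝ × ℝ), IsCopulaMeasure (maxminFun φ ψ) μ →
        (μ.singularPart (volume : Measure (ℝ × ℝ))) (maxminCurve φ ψ)ᶜ = 0) ∧
    (∀ C : ℝ → ℝ → ℝ,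
      (IsMaxminCopula C ∧ IsFullySingular C) ↔
        ∀ u ∈ Icc (0 : ℝ) 1, ∀ v ∈ Icc (0 : ℝ) 1, C u v = min u v) := by
  refine ⟨fun φ ψ H => ⟨⟨_, H.isCopulaMeasure, fun ν hν => hν.unique H.isCopulaMeasure⟩,
    fun μ hμ => ?_⟩, fun C => ⟨?_, fun hC => ?_⟩⟩
  · rw [hμ.unique H.isCopulaMeasure]
    exact H.singularPart_compl_maxminCurve
  · rintro ⟨⟨φ, ψ, H, hC⟩, μ, hμ, hsing⟩ u hu v hv
    rw [(hμ.congr hC).unique H.isCopulaMeasure] at hsing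
    rw [hC u hu v hv, H.eq_min_of_mutuallySingular hsing hu hv]
  · obtain ⟨φ, ψ, H, hmin⟩ := isMaxminCopula_min
    obtain ⟨μ, hμ, hsing⟩ := isFullySingular_min
    exact ⟨⟨φ, ψ, H, fun u hu v hv => (hC u hu v hv).trans (hmin u hu v hv)⟩,
      μ, hμ.congr fun u hu v hv => (hC u hu v hv).symm, hsing⟩
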